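/- Let $J$ be a self-adjoint involution, $J\neq I$, on a complex Hilbert space $\mathfrak H$, and let $\mathfrak H_0=\ker(J-I)$, $\mathfrak H_1=\ker(J+I)$, so that $\mathfrak H=\mathfrak H_0\oplus\mathfrak H_1$. Let $A$ be a (possibly unbounded) self-adjoint operator on $\mathfrak H$ commuting with $J$, and let $V$ be a bounded operator on $\mathfrak H$ that anti-commutes with $J$ and is $J$-self-adjoint, i.e. $(JV)^*=JV$. Thus, with respect to this decomposition, $$A=\begin{pmatrix}A_0&0\\0&A_1\end{pmatrix},\qquad V=\begin{pmatrix}0&B\\-B^*&0\end{pmatrix},$$ with $A_0,A_1$ self-adjoint and $B\in\mathcal B(\mathfrak H_1,\mathfrak H_0)$. (a) Suppose that $A_0$ is bounded and that $K\in\mathcal B(\mathfrak H_0,\mathfrak H_1)$ with $\|K\|<1$ is a weak solution of the Riccati equation $KA_0-A_1K+KBK=-B^*$, i.e. $(KA_0x,y)-(Kx,A_1^*y)+(KBKx,y)=-(B^*x,y)$ for all $x\in\mathrm{Dom}(A_0)$ and $y\in\mathrm{Dom}(A_1^*)$. Let $Z_0=A_0+BK$ with $\mathrm{Dom}(Z_0)=\mathrm{Dom}(A_0)$,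 let $Z_1=A_1-B^*K^*$ with $\mathrm{Dom}(Z_1)=\mathrm{Dom}(A_1)$, and let $\delta=\mathrm{dist}(\mathrm{spec}(Z_0),\mathrm{spec}(Z_1))$. If $\mathrm{spec}(Z_0)$ lies in a finite or infinite gap of $\mathrm{spec}(Z_1)$, that is, if $$\mathrm{conv}(\mathrm{spec}(Z_0))\cap\mathrm{spec}(Z_1)=\emptyset,$$ then $$\|K\|\le\frac{\|B\|}{\sqrt{\delta^2+\|B\|^2}}.$$ (In the degenerate cases the conventions are $\mathrm{dist}=0$ if one of the spectra is empty and $0/0=0$.) (b) The bound is sharp for finite gaps: for all real $\beta\ge0$ and $\delta>0$ there are $\mathfrak H,J,A,V$ as above, with $A_0$ bounded, and a $K\in\mathcal B(\mathfrak H_0,\mathfrak H_1)$ with $\|K\|<1$ that is a strong solution of the Riccati equation (i.e. $Kx\in\mathrm{Dom}(A_1)$ and $KA_0x-A_1Kx+KBKx=-B^*x$ for all $x\in\mathrm{Dom}(A_0)$), such that $\mathrm{spec}(Z_0)\subset(a,b)$ for some finite gap $(a,b)$ of $\mathrm{spec}(Z_1)$ (that is, $a<b$ are real, $a,b\in\mathrm{spec}(Z_1)$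 and $(a,b)\cap\mathrm{spec}(Z_1)=\emptyset$), $\|B\|=\beta$, $\mathrm{dist}(\mathrm{spec}(Z_0),\mathrm{spec}(Z_1))=\delta$, and $\|K\|=\beta/\sqrt{\delta^2+\beta^2}$. -/

import Mathlib

open scoped InnerProductSpace

noncomputable section

/-! ### Unbounded operators on a complex Hilbert space -/

section Operators

variable {E : Type*} [NormedAddCommGroup E] [InnerProductSpace ℂ E]

/-- The resolvent set of a (possibly unbounded) operator `T`: the points `z` such that
`T - z : Dom T → E` has an everywhere defined bounded two-sided inverse `R`. -/
def opResolventSet (T : E →ₗ.[ℂ] E) : Set ℂ :=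
  {z | ∃ R : E →L[ℂ] E,
    (∀ y : E, ∃ h : R y ∈ T.domain, T ⟨R y, h⟩ - z • R y = y) ∧
    (∀ x : T.domain, R (T x - z • (x : E)) = (x : E))}

/-- The spectrum of a (possibly unbounded) operator. -/
def opSpectrum (T : E →ₗ.[ℂ] E) : Set ℂ := (opResolventSet T)ᶜ

/-- An operator is bounded (on its domain). -/
def IsBoundedOp (T : E →ₗ.[ℂ] E) : Prop :=
  ∃ C : ℝ, ∀ x : T.domain, ‖T x‖ ≤ C * ‖(x : E)‖

/-- The sum `T + S` of an operator `T` and an everywhere defined bounded operator `S`,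
with `Dom (T + S) = Dom T`. -/
def addBounded (T : E →ₗ.[ℂ] E) (S : E →L[ℂ] E) : E →ₗ.[ℂ] E where
  domain := T.domain
  toFun := T.toFun + (S : E →ₗ[ℂ] E).comp T.domain.subtype

/-- The part of `A` in a subspace `M` that `A` maps into itself: its domain is `M ∩ Dom A`. -/
def partIn (A : E →ₗ.[ℂ] E) (M : Submodule ℂ E)
    (hM : ∀ x : A.domain, (x : E) ∈ M → A x ∈ M) : M →ₗ.[ℂ] M where
  domain := A.domain.comap M.subtype
  toFun :=
    { toFun := fun x => ⟨A ⟨((x : M) : E), x.2⟩, hM ⟨((x : M) : E), x.2⟩ (x : M).2⟩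
      map_add' := fun x y => Subtype.ext (A.map_add ⟨((x : M) : E), x.2⟩ ⟨((y : M) : E), y.2⟩)
      map_smul' := fun c x => Subtype.ext (A.map_smul c ⟨((x : M) : E), x.2⟩) }

end Operators

/-- The distance between two sets of complex numbers (`0` by convention if one is empty). -/
def setDist (s t : Set ℂ) : ℝ := sInf {r : ℝ | ∃ z ∈ s, ∃ w ∈ t, r = dist z w}

/-- The open interval `(a, b)`, `-∞ < a < b < ∞`, is a finite gap of `σ`. -/
def IsFiniteGap (σ : Set ℂ) (a b : ℝ) : Prop :=
  a < b ∧ (a : ℂ) ∈ σ ∧ (b : ℂ) ∈ σ ∧ ∀ t : ℝ, a < t → t < b → (t : ℂ) ∉ σ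

/-! ### Off-diagonal `J`-self-adjoint perturbations -/

/-- A self-adjoint involution `J ≠ I` on `H`, a (possibly unbounded) self-adjoint operator `A`
commuting with `J`, and a bounded `J`-self-adjoint operator `V` anti-commuting with `J`.
The perturbed operator is `L = A + V`. -/
structure JPerturbation (H : Type*) [NormedAddCommGroup H] [InnerProductSpace ℂ H]
    [CompleteSpace H] where
  J : H →L[ℂ] H
  J_selfAdjoint : IsSelfAdjoint J
  J_involution : J * J = 1
  J_ne_one : J ≠ 1
  A : H →ₗ.[ℂ] H
  A_selfAdjoint : IsSelfAdjoint A
  A_comm : ∀ x : A.domain, ∃ h : J (x : H) ∈ A.domain, A ⟨J (x : H), h⟩ = J (A x)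
  V : H →L[ℂ] H
  V_selfAdjoint : IsSelfAdjoint (J * V)
  V_anticomm : J * V = -(V * J)

namespace JPerturbation

variable {H : Type*} [NormedAddCommGroup H] [InnerProductSpace ℂ H] [CompleteSpace H]
  (S : JPerturbation H)

/-- The spectral subspace of `J` for the eigenvalue `1`. -/
def H₀ : Submodule ℂ H := LinearMap.ker ((S.J - 1 : H →L[ℂ] H) : H →ₗ[ℂ] H)

/-- The spectral subspace of `J` for the eigenvalue `-1`. -/
def H₁ : Submodule ℂ H := LinearMap.ker ((S.J + 1 : H →L[ℂ] H) : H →ₗ[ℂ] H)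

theorem mem_H₀ {x : H} : x ∈ S.H₀ ↔ S.J x = x := by
  simp [H₀, sub_eq_zero]

theorem mem_H₁ {x : H} : x ∈ S.H₁ ↔ S.J x = -x := by
  simp [H₁, add_eq_zero_iff_eq_neg]

instance : CompleteSpace S.H₀ :=
  inferInstanceAs (CompleteSpace (LinearMap.ker ((S.J - 1 : H →L[ℂ] H) : H →ₗ[ℂ] H)))

instance : CompleteSpace S.H₁ :=
  inferInstanceAs (CompleteSpace (LinearMap.ker ((S.J + 1 : H →L[ℂ] H) : H →ₗ[ℂ] H)))

theorem A_mem_H₀ (x : S.A.domain) (hx : (x : H) ∈ S.H₀) : S.A x ∈ S.H₀ := by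
  rw [mem_H₀] at hx ⊢
  obtain ⟨h, e⟩ := S.A_comm x
  rw [← e]
  exact congrArg S.A (Subtype.ext hx)

theorem A_mem_H₁ (x : S.A.domain) (hx : (x : H) ∈ S.H₁) : S.A x ∈ S.H₁ := by
  rw [mem_H₁] at hx ⊢
  obtain ⟨h, e⟩ := S.A_comm x
  rw [← e, ← S.A.map_neg]
  exact congrArg S.A (Subtype.ext hx)

theorem V_mem_H₀ (x : H) (hx : x ∈ S.H₁) : S.V x ∈ S.H₀ := by
  rw [mem_H₁] at hx
  rw [mem_H₀]
  have e := congrArg (fun f : H →L[ℂ] H => f x) S.V_anticomm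
  simpa [hx] using e

/-- The diagonal entry `A₀` of `A`, an operator on `H₀`. -/
def A₀ : S.H₀ →ₗ.[ℂ] S.H₀ := partIn S.A S.H₀ S.A_mem_H₀

/-- The diagonal entry `A₁` of `A`, an operator on `H₁`. -/
def A₁ : S.H₁ →ₗ.[ℂ] S.H₁ := partIn S.A S.H₁ S.A_mem_H₁

/-- The off-diagonal entry `B = V|_{H₁} : H₁ → H₀` of `V`. -/
def B : S.H₁ →L[ℂ] S.H₀ :=
  (S.V.comp S.H₁.subtypeL).codRestrict S.H₀ fun x => S.V_mem_H₀ x x.2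

/-- `K` is a weak solution of the Riccati equation `K A₀ - A₁ K + K B K = -B*`. The scalar product
`(u, v)` that is linear in `u` is `⟪v, u⟫_ℂ`. -/
def IsWeakRiccatiSolution (K : S.H₀ →L[ℂ] S.H₁) : Prop :=
  ∀ (x : S.A₀.domain) (y : S.A₁.adjoint.domain),
    ⟪(y : S.H₁), K (S.A₀ x)⟫_ℂ - ⟪S.A₁.adjoint y, K x⟫_ℂ + ⟪(y : S.H₁), K (S.B (K x))⟫_ℂ
      = -⟪(y : S.H₁), S.B.adjoint (x : S.H₀)⟫_ℂ

/-- `K` is a strong solution of the Riccati equation `K A₀ - A₁ K + K B K = -B*`. -/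
def IsStrongRiccatiSolution (K : S.H₀ →L[ℂ] S.H₁) : Prop :=
  ∀ x : S.A₀.domain, ∃ h : K (x : S.H₀) ∈ S.A₁.domain,
    K (S.A₀ x) - S.A₁ ⟨K (x : S.H₀), h⟩ + K (S.B (K x)) = -S.B.adjoint (x : S.H₀)

/-- `Z₀ = A₀ + B K` with `Dom Z₀ = Dom A₀`. -/
def Z₀ (K : S.H₀ →L[ℂ] S.H₁) : S.H₀ →ₗ.[ℂ] S.H₀ := addBounded S.A₀ (S.B.comp K)

/-- `Z₁ = A₁ - B* K*` with `Dom Z₁ = Dom A₁`. -/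
def Z₁ (K : S.H₀ →L[ℂ] S.H₁) : S.H₁ →ₗ.[ℂ] S.H₁ :=
  addBounded S.A₁ (-(S.B.adjoint.comp K.adjoint))

/-- `δ = dist (spec Z₀, spec Z₁)`. -/
def delta (K : S.H₀ →L[ℂ] S.H₁) : ℝ :=
  setDist (opSpectrum (S.Z₀ K)) (opSpectrum (S.Z₁ K))

end JPerturbation

end

/-! (a) A weak solution is strong because `A₁` is self-adjoint, so with `T = A₀ + BK` one has `A₁K =
KT + B*`. Let `c` and `r` be the centre and half-length of the smallest real interval containing
spec `Z₀`. By the gap hypothesis `R = (Z₁ - c)⁻¹` exists, and the equation becomes `Ku = R(K(T - c)u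
+ B*(1 - K*K)u)`. The operators `T - c` and `R` are symmetric for the forms of `1 - K*K` and `1 -
KK*`, which are positive definite as `‖K‖ < 1`. In the norms `‖P·‖`, `‖Q·‖` of the square roots `P`,
`Q` they are therefore bounded by their spectral radii: at most `r` and some `ρ` with, unless `ρ =
0`, `1/ρ ≥ r + δ`. Taking the `Q`-norm of the equation at unit vectors `u` with `‖Ku‖` near `‖K‖`
gives, with `s = √(1 - ‖K‖²)`, `‖K‖s ≤ ρ(‖K‖rs + ‖B‖s²)`. Hence `‖K‖δ ≤ ‖B‖s`, which is the bound.
The analytic core is `norm_le_of_sylvester`; `norm_le_of_isStrongRiccatiSolution` supplies its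
hypotheses. (b) A `3 × 3` example with `BK = 0` makes `Z₀ = 0` and gives `Z₁` the eigenvalues `±δ`.
-/

open scoped InnerProductSpace

/-! ### Symmetric operators in weighted norms, and the norm estimate. -/

section WeightedNorm

/-- The norm of an operator is a limit of norms of images of unit vectors. -/
theorem norm_mem_of_isClosed {E F : Type*} [NormedAddCommGroup E] [NormedSpace ℂ E]
    [NormedAddCommGroup F] [NormedSpace ℂ F] {K : E →L[ℂ] F} (hK : 0 < ‖K‖) {s : Set ℝ} (hs : IsClosed s)
    (h : ∀ u : E, ‖u‖ = 1 → ‖K u‖ ∈ s) : ‖K‖ ∈ s := by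
  have : Nontrivial E := by
    by_contra hE
    rw [not_nontrivial_iff_subsingleton] at hE
    have : K = 0 := by ext x; simp [Subsingleton.elim x 0]
    simp [this] at hK
  rw [← hs.closure_eq, ← K.sSup_sphere_eq_norm]
  have hne : ((fun x => ‖K x‖) '' Metric.sphere (0 : E) 1).Nonempty := by
    obtain ⟨x, hx⟩ := NormedSpace.sphere_nonempty (x := (0 : E)) (r := 1) |>.2 zero_le_one
    exact ⟨_, x, hx, rfl⟩
  refine closure_mono ?_ (csSup_mem_closure hne ?_)
  · rintro _ ⟨u, hu, rfl⟩
    exact h u (by simpa using hu)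
  · refine ⟨‖K‖, ?_⟩
    rintro _ ⟨u, hu, rfl⟩
    have := K.le_opNorm u
    rw [mem_sphere_zero_iff_norm] at hu
    simpa [hu] using this

variable {E F : Type*} [NormedAddCommGroup E] [InnerProductSpace ℂ E] [CompleteSpace E]
  [NormedAddCommGroup F] [InnerProductSpace ℂ F] [CompleteSpace F]

/-- The positive operator `1 - C* C` of a strict contraction `C` has an invertible self-adjoint
square root. -/
theorem exists_unit_sqrt_one_sub (C : E →L[ℂ] F) (hC : ‖C‖ < 1) :
    ∃ P : (E →L[ℂ] E)ˣ, IsSelfAdjoint (P : E →L[ℂ] E) ∧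
      (P : E →L[ℂ] E) * P = 1 - C.adjoint ∘L C := by
  have hM : ‖C.adjoint ∘L C‖ < 1 := by
    rw [ContinuousLinearMap.norm_adjoint_comp_self]
    nlinarith [norm_nonneg C]
  have hpos : (0 : E →L[ℂ] E) ≤ 1 - C.adjoint ∘L C := by
    rw [ContinuousLinearMap.nonneg_iff_isPositive, ContinuousLinearMap.isPositive_iff_complex]
    intro x
    have h : ⟪((1 : E →L[ℂ] E) - C.adjoint ∘L C) x, x⟫_ℂ = ((‖x‖ ^ 2 - ‖C x‖ ^ 2 : ℝ) : ℂ) := by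
      simp [ContinuousLinearMap.adjoint_inner_left]
    rw [h]
    refine ⟨congrArg _ (Complex.ofReal_re _), ?_⟩
    rw [show RCLike.re ((‖x‖ ^ 2 - ‖C x‖ ^ 2 : ℝ) : ℂ) = ‖x‖ ^ 2 - ‖C x‖ ^ 2 from
      Complex.ofReal_re _]
    have := C.le_opNorm x
    have h2 : ‖C x‖ ≤ ‖x‖ := this.trans (mul_le_of_le_one_left (norm_nonneg x) hC.le)
    have := pow_le_pow_left₀ (norm_nonneg _) h2 2
    linarith
  have hu : IsUnit (CFC.sqrt ((1 : E →L[ℂ] E) - C.adjoint ∘L C)) := by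
    rw [CFC.isUnit_sqrt_iff _ hpos]
    exact isUnit_one_sub_of_norm_lt_one hM
  obtain ⟨P, hP⟩ := hu
  refine ⟨P, ?_, ?_⟩
  · rw [hP]
    exact IsSelfAdjoint.of_nonneg (CFC.sqrt_nonneg _)
  · rw [hP]
    exact CFC.sqrt_mul_sqrt_self _ hpos

theorem norm_sq_sqrt_one_sub {C : E →L[ℂ] F} {P : E →L[ℂ] E} (hP : IsSelfAdjoint P)
    (hPP : P * P = 1 - C.adjoint ∘L C) (x : E) : ‖P x‖ ^ 2 = ‖x‖ ^ 2 - ‖C x‖ ^ 2 := by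
  have h1 : ⟪P x, P x⟫_ℂ = ⟪(P * P) x, x⟫_ℂ := by
    rw [mul_apply_eq_comp]
    exact ((ContinuousLinearMap.isSelfAdjoint_iff_isSymmetric.1 hP) (P x) x).symm
  rw [hPP] at h1
  have h2 : ((‖P x‖ ^ 2 : ℝ) : ℂ) = ((‖x‖ ^ 2 - ‖C x‖ ^ 2 : ℝ) : ℂ) := by
    simpa [inner_sub_left, ContinuousLinearMap.adjoint_inner_left] using h1
  exact_mod_cast h2

/-- `T` is symmetric for the form `⟪x, y⟫ - ⟪C x, C y⟫`. -/
def IsWeightedSymmetric (C : E →L[ℂ] F) (T : E →L[ℂ] E) : Prop :=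
  ∀ x y : E, ⟪T x, y⟫_ℂ - ⟪C (T x), C y⟫_ℂ = ⟪x, T y⟫_ℂ - ⟪C x, C (T y)⟫_ℂ

/-- Weighted symmetry is `T*P² = P²T`; multiplying by `P⁻¹` on both sides gives `P⁻¹T*P = PTP⁻¹`. -/
theorem IsWeightedSymmetric.isSelfAdjoint_conj {C : E →L[ℂ] F} {T : E →L[ℂ] E}
    (hT : IsWeightedSymmetric C T) {P : (E →L[ℂ] E)ˣ} (hP : IsSelfAdjoint (P : E →L[ℂ] E))
    (hPP : (P : E →L[ℂ] E) * P = 1 - C.adjoint ∘L C) :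
    IsSelfAdjoint ((P : E →L[ℂ] E) * T * (↑P⁻¹ : E →L[ℂ] E)) := by
  have hG : star T * ((P : E →L[ℂ] E) * P) = ((P : E →L[ℂ] E) * P) * T := by
    rw [hPP]
    ext x
    refine ext_inner_right ℂ fun y => ?_
    have := hT x y
    simp only [mul_apply_eq_comp, ContinuousLinearMap.star_eq_adjoint,
      ContinuousLinearMap.adjoint_inner_left, sub_apply,
      one_apply_eq_self, ContinuousLinearMap.comp_apply, inner_sub_left]
    exact this.symm
  have hPs : star (P : E →L[ℂ] E) = P := hP
  have hPi : star (↑P⁻¹ : E →L[ℂ] E) = ↑P⁻¹ := by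
    rw [← Units.coe_star_inv]
    congr 2
    exact Units.ext hPs
  rw [IsSelfAdjoint, star_mul, star_mul, hPs, hPi]
  calc (↑P⁻¹ : E →L[ℂ] E) * (star T * P)
      = (↑P⁻¹ : E →L[ℂ] E) * (star T * (P * P)) * (↑P⁻¹ : E →L[ℂ] E) := by simp [mul_assoc]
    _ = _ := by rw [hG]; simp [mul_assoc]

theorem IsWeightedSymmetric.im_eq_zero {C : E →L[ℂ] F} (hC : ‖C‖ < 1) {T : E →L[ℂ] E}
    (hT : IsWeightedSymmetric C T) {z : ℂ} (hz : z ∈ spectrum ℂ T) : z.im = 0 := by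
  obtain ⟨P, hP, hPP⟩ := exists_unit_sqrt_one_sub C hC
  rw [← spectrum.units_conjugate (u := P)] at hz
  exact (hT.isSelfAdjoint_conj hP hPP).im_eq_zero_of_mem_spectrum hz

/-- `PTP⁻¹` is self-adjoint with the spectrum of `T`, so its norm equals the spectral radius of `T`.
-/
theorem IsWeightedSymmetric.norm_le {C : E →L[ℂ] F} {T : E →L[ℂ] E}
    (hT : IsWeightedSymmetric C T) {P : (E →L[ℂ] E)ˣ} (hP : IsSelfAdjoint (P : E →L[ℂ] E))
    (hPP : (P : E →L[ℂ] E) * P = 1 - C.adjoint ∘L C) {ρ : ℝ} (hρ : 0 ≤ ρ)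
    (h : ∀ z ∈ spectrum ℂ T, ‖z‖ ≤ ρ) (x : E) :
    ‖(P : E →L[ℂ] E) (T x)‖ ≤ ρ * ‖(P : E →L[ℂ] E) x‖ := by
  set L := (P : E →L[ℂ] E) * T * (↑P⁻¹ : E →L[ℂ] E) with hL
  have hn : ‖L‖ ≤ ρ := by
    have h1 := (hT.isSelfAdjoint_conj hP hPP).spectralRadius_eq_nnnorm
    have h2 : spectralRadius ℂ L ≤ ENNReal.ofNNReal ⟨ρ, hρ⟩ := by
      refine iSup₂_le fun z hz => ?_
      rw [hL, spectrum.units_conjugate] at hz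
      exact ENNReal.coe_le_coe.2 (h z hz)
    rw [← hL] at h1
    rw [h1] at h2
    exact ENNReal.coe_le_coe.1 h2
  have h3 : (P : E →L[ℂ] E) (T x) = L ((P : E →L[ℂ] E) x) := by
    have : L * (P : E →L[ℂ] E) = (P : E →L[ℂ] E) * T := by simp [hL, mul_assoc]
    exact (congrArg (fun f : E →L[ℂ] E => f x) this).symm
  rw [h3]
  exact (L.le_opNorm _).trans (mul_le_mul_of_nonneg_right hn (norm_nonneg _))

/-- With `M = K*K` and `k = ‖K‖`, this is the positivity of `(k² - M)(1 - M) = (k² - M)² + (1 -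
k²)(k² - M)`. It yields `‖QKv‖ ≤ ‖K‖‖Pv‖`. -/
theorem norm_sq_sub_norm_sq_adjoint_le (K : E →L[ℂ] F) (hK : ‖K‖ < 1) (v : E) :
    ‖K v‖ ^ 2 - ‖K.adjoint (K v)‖ ^ 2 ≤ ‖K‖ ^ 2 * (‖v‖ ^ 2 - ‖K v‖ ^ 2) := by
  have h1 : ‖((‖K‖ ^ 2 : ℝ) : ℂ) • v - K.adjoint (K v)‖ ^ 2
      = ‖K‖ ^ 4 * ‖v‖ ^ 2 - 2 * ‖K‖ ^ 2 * ‖K v‖ ^ 2 + ‖K.adjoint (K v)‖ ^ 2 := by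
    rw [@norm_sub_sq ℂ, inner_smul_left, ContinuousLinearMap.adjoint_inner_right,
      inner_self_eq_norm_sq_to_K, norm_smul]
    have : RCLike.re ((starRingEnd ℂ) ((‖K‖ ^ 2 : ℝ) : ℂ) * (‖K v‖ : ℂ) ^ 2)
        = ‖K‖ ^ 2 * ‖K v‖ ^ 2 := by
      rw [Complex.conj_ofReal]
      norm_cast
    erw [this]
    simp
    ring
  have h2 := K.le_opNorm v
  have h3 : ‖K v‖ ^ 2 ≤ ‖K‖ ^ 2 * ‖v‖ ^ 2 := by
    rw [← mul_pow]; exact pow_le_pow_left₀ (norm_nonneg _) h2 2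
  have h4 : 0 ≤ 1 - ‖K‖ ^ 2 := by nlinarith [norm_nonneg K]
  nlinarith [sq_nonneg ‖((‖K‖ ^ 2 : ℝ) : ℂ) • v - K.adjoint (K v)‖,
    mul_nonneg h4 (sub_nonneg.2 h3)]

theorem norm_sq_sub_adjoint_apply_le (K : E →L[ℂ] F) {u : E} (hu : ‖u‖ = 1) :
    ‖u - K.adjoint (K u)‖ ^ 2 ≤ 1 - 2 * ‖K u‖ ^ 2 + ‖K‖ ^ 2 * ‖K u‖ ^ 2 := by
  have h1 : ‖u - K.adjoint (K u)‖ ^ 2 = 1 - 2 * ‖K u‖ ^ 2 + ‖K.adjoint (K u)‖ ^ 2 := by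
    rw [@norm_sub_sq ℂ, ContinuousLinearMap.adjoint_inner_right, inner_self_eq_norm_sq_to_K, hu]
    have : RCLike.re ((‖K u‖ : ℂ) ^ 2) = ‖K u‖ ^ 2 := by norm_cast
    erw [this]
    ring
  have h2 := K.adjoint.le_opNorm (K u)
  rw [ContinuousLinearMap.adjoint.norm_map] at h2
  have h3 := pow_le_pow_left₀ (norm_nonneg _) h2 2
  rw [mul_pow] at h3
  linarith

/-- A norm bound for a strict contraction `K` satisfying `K u = R (K T u + B* (u - K* K u))`, where
`T` and `R` are symmetric for the forms weighted by `K` and `K*`. -/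
theorem norm_le_of_sylvester {K : E →L[ℂ] F} (hK : ‖K‖ < 1) (B : F →L[ℂ] E) {T : E →L[ℂ] E}
    {R : F →L[ℂ] F} (hT : IsWeightedSymmetric K T) (hR : IsWeightedSymmetric K.adjoint R)
    {r ρ δ : ℝ} (hr : 0 ≤ r) (hρ : 0 ≤ ρ) (hδ : 0 ≤ δ) (hTr : ∀ z ∈ spectrum ℂ T, ‖z‖ ≤ r)
    (hRρ : ∀ z ∈ spectrum ℂ R, ‖z‖ ≤ ρ) (h1 : ρ * (r + δ) ≤ 1) (h2 : ρ * r < 1)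
    (hKR : ∀ u, K u = R (K (T u) + B.adjoint (u - K.adjoint (K u)))) :
    ‖K‖ ≤ ‖B‖ / √(δ ^ 2 + ‖B‖ ^ 2) := by
  rcases (norm_nonneg K).eq_or_lt with h0 | hpos
  · rw [← h0]; positivity
  have hs2 : 0 < 1 - ‖K‖ ^ 2 := by nlinarith
  set s := √(1 - ‖K‖ ^ 2) with hs
  have hspos : 0 < s := Real.sqrt_pos.2 hs2
  have hss : s ^ 2 = 1 - ‖K‖ ^ 2 := Real.sq_sqrt hs2.le
  obtain ⟨P, hP, hPP⟩ := exists_unit_sqrt_one_sub K hK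
  obtain ⟨Q, hQ, hQQ⟩ := exists_unit_sqrt_one_sub K.adjoint
    (by rwa [ContinuousLinearMap.adjoint.norm_map])
  have nP := norm_sq_sqrt_one_sub hP hPP
  have nQ := norm_sq_sqrt_one_sub hQ hQQ
  have hQ1 (y : F) : ‖(Q : F →L[ℂ] F) y‖ ≤ ‖y‖ := by
    refine (abs_le_of_sq_le_sq' ?_ (norm_nonneg _)).2
    rw [nQ]
    nlinarith [sq_nonneg ‖K.adjoint y‖]
  have hQK (v : E) : ‖(Q : F →L[ℂ] F) (K v)‖ ≤ ‖K‖ * ‖(P : E →L[ℂ] E) v‖ := by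
    refine (abs_le_of_sq_le_sq' ?_ (by positivity)).2
    rw [nQ, mul_pow, nP]
    exact norm_sq_sub_norm_sq_adjoint_le K hK v
  -- Only `‖Ku‖` is turned into the variable `t`. The inequality is closed in `t`, so it passes to
  -- `t = ‖K‖` even if the norm is not attained; there the two roots become `s` and `s²`.
  have key : ‖K‖ ∈ {t : ℝ | t * s ≤
      ρ * (‖K‖ * (r * √(1 - t ^ 2)) + ‖B‖ * √(1 - 2 * t ^ 2 + ‖K‖ ^ 2 * t ^ 2))} := by
    refine norm_mem_of_isClosed hpos (isClosed_le (by fun_prop) (by fun_prop)) fun u hu => ?_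
    have e1 : ‖K u‖ * s ≤ ‖(Q : F →L[ℂ] F) (K u)‖ := by
      refine (abs_le_of_sq_le_sq' ?_ (norm_nonneg _)).2
      have h3 := K.adjoint.le_opNorm (K u)
      rw [ContinuousLinearMap.adjoint.norm_map] at h3
      have h4 := pow_le_pow_left₀ (norm_nonneg _) h3 2
      rw [nQ, mul_pow, hss]
      rw [mul_pow] at h4
      linarith
    have e2 : ‖(P : E →L[ℂ] E) u‖ = √(1 - ‖K u‖ ^ 2) := by
      rw [← Real.sqrt_sq (norm_nonneg ((P : E →L[ℂ] E) u)), nP, hu, one_pow]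
    have e3 : ‖u - K.adjoint (K u)‖ ≤ √(1 - 2 * ‖K u‖ ^ 2 + ‖K‖ ^ 2 * ‖K u‖ ^ 2) :=
      Real.le_sqrt_of_sq_le (norm_sq_sub_adjoint_apply_le K hu)
    calc ‖K u‖ * s ≤ ‖(Q : F →L[ℂ] F) (K u)‖ := e1
      _ ≤ ρ * ‖(Q : F →L[ℂ] F) (K (T u) + B.adjoint (u - K.adjoint (K u)))‖ := by
        conv_lhs => rw [hKR u]
        exact hR.norm_le hQ hQQ hρ hRρ _
      _ ≤ _ := by
        refine mul_le_mul_of_nonneg_left ?_ hρ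
        rw [map_add]
        refine (norm_add_le _ _).trans (add_le_add ?_ ?_)
        · refine (hQK _).trans (mul_le_mul_of_nonneg_left ?_ hpos.le)
          rw [← e2]
          exact hT.norm_le hP hPP hr hTr u
        · refine (hQ1 _).trans ((B.adjoint.le_opNorm _).trans ?_)
          rw [ContinuousLinearMap.adjoint.norm_map]
          exact mul_le_mul_of_nonneg_left e3 (norm_nonneg _)
  have e4 : √(1 - 2 * ‖K‖ ^ 2 + ‖K‖ ^ 2 * ‖K‖ ^ 2) = s * s := by
    rw [show 1 - 2 * ‖K‖ ^ 2 + ‖K‖ ^ 2 * ‖K‖ ^ 2 = (s * s) ^ 2 by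
      rw [mul_pow, hss]; ring]
    exact Real.sqrt_sq (by positivity)
  rw [Set.mem_ofPred_eq, e4, ← hs] at key
  have key2 : ‖K‖ ≤ ρ * (‖K‖ * r + ‖B‖ * s) := by
    refine le_of_mul_le_mul_right ?_ hspos
    linarith
  have key3 : ‖K‖ * (1 - ρ * r) ≤ ρ * (‖B‖ * s) := by linarith
  -- The strict inequality `ρr < 1` rules out `B = 0` when `K ≠ 0`, even for `δ = 0`; this covers
  -- the `0/0` convention.
  have hlt : 0 < ρ * (‖B‖ * s) := lt_of_lt_of_le (mul_pos hpos (by linarith)) key3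
  have hρ' : 0 < ρ := by
    rcases hρ.eq_or_lt with h | h
    · rw [← h] at hlt; simp at hlt
    · exact h
  have hB : 0 < ‖B‖ := by
    rcases (norm_nonneg B).eq_or_lt with h | h
    · rw [← h] at hlt; simp at hlt
    · exact h
  have key4 : ‖K‖ * δ ≤ ‖B‖ * s := by
    refine le_of_mul_le_mul_left ?_ hρ'
    have : ρ * δ ≤ 1 - ρ * r := by linarith
    have := mul_le_mul_of_nonneg_left this hpos.le
    linarith
  have key5 := pow_le_pow_left₀ (by positivity) key4 2
  rw [mul_pow, mul_pow, hss] at key5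
  rw [le_div_iff₀ (by positivity)]
  refine (abs_le_of_sq_le_sq' ?_ hB.le).2
  rw [mul_pow, Real.sq_sqrt (by positivity)]
  linarith

end WeightedNorm

/-! ### Resolvents of unbounded operators and reduced parts of self-adjoint operators. -/

section UnboundedOperators

variable {E : Type*} [NormedAddCommGroup E] [InnerProductSpace ℂ E]

theorem opSpectrum_eq_spectrum {T : E →ₗ.[ℂ] E} {t : E →L[ℂ] E}
    (h : ∀ x, ∃ hx : x ∈ T.domain, T ⟨x, hx⟩ = t x) : opSpectrum T = spectrum ℂ t := by
  unfold opSpectrum spectrum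
  congr 1
  ext z
  have hT (x : T.domain) : T x = t x := (h x).2
  have hmem (x : E) : x ∈ T.domain := (h x).1
  simp only [opResolventSet, resolventSet, Set.mem_ofPred_eq, hT]
  constructor
  · rintro ⟨R, h1, h2⟩
    -- The sign appears because `R` inverts `T - z`, while `spectrum` concerns `z - t`.
    refine isUnit_iff_exists.2 ⟨-R, ?_, ?_⟩
    · ext y
      obtain ⟨-, hy⟩ := h1 y
      simpa [Algebra.algebraMap_eq_smul_one, sub_eq_add_neg, add_comm] using hy
    · ext y
      have hy := h2 ⟨y, hmem y⟩
      simp only [map_sub] at hy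
      simpa [Algebra.algebraMap_eq_smul_one, sub_eq_add_neg, add_comm] using hy
  · rintro ⟨U, hU⟩
    have e1 : (U : E →L[ℂ] E) * (↑U⁻¹ : E →L[ℂ] E) = 1 := U.mul_inv
    have e2 : (↑U⁻¹ : E →L[ℂ] E) * (U : E →L[ℂ] E) = 1 := U.inv_mul
    rw [hU] at e1 e2
    refine ⟨-(↑U⁻¹ : E →L[ℂ] E), fun y => ⟨hmem _, ?_⟩, fun x => ?_⟩
    · have := congrArg (fun f : E →L[ℂ] E => f y) e1
      simpa [Algebra.algebraMap_eq_smul_one, sub_eq_add_neg, add_comm] using this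
    · have := congrArg (fun f : E →L[ℂ] E => f x) e2
      simp only [Algebra.algebraMap_eq_smul_one, mul_apply_eq_comp, sub_apply, one_apply_eq_self,
        smul_apply, map_sub] at this
      simpa [sub_eq_add_neg, add_comm] using this

/-- Spectral mapping for the resolvent of an unbounded operator. -/
theorem add_inv_mem_opSpectrum {T : E →ₗ.[ℂ] E} {c : ℂ} {R : E →L[ℂ] E}
    (h1 : ∀ y : E, ∃ h : R y ∈ T.domain, T ⟨R y, h⟩ - c • R y = y)
    (h2 : ∀ x : T.domain, R (T x - c • (x : E)) = (x : E)) {μ : ℂ} (hμ : μ ≠ 0)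
    (hs : μ ∈ spectrum ℂ R) : c + μ⁻¹ ∈ opSpectrum T := by
  rintro ⟨R', g1, g2⟩
  refine hs ?_
  -- The two resolvent identities for `c` and `c + μ⁻¹`; they make `μ⁻¹(1 + μ⁻¹R')` a two-sided
  -- inverse of `μ - R`.
  have e1 (y : E) : R y + μ⁻¹ • R (R' y) = R' y := by
    obtain ⟨h, e⟩ := g1 y
    have := h2 ⟨R' y, h⟩
    have e' : T ⟨R' y, h⟩ - c • R' y = y + μ⁻¹ • R' y := by
      rw [eq_add_of_sub_eq e]
      module
    simpa only [e', map_add, map_smul] using this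
  have e2 (y : E) : R' y - μ⁻¹ • R' (R y) = R y := by
    obtain ⟨h, e⟩ := h1 y
    have := g2 ⟨R y, h⟩
    have e' : T ⟨R y, h⟩ - (c + μ⁻¹) • R y = y - μ⁻¹ • R y := by
      rw [eq_add_of_sub_eq e]
      module
    simpa only [e', map_sub, map_smul] using this
  refine isUnit_iff_exists.2 ⟨μ⁻¹ • (1 + μ⁻¹ • R'), ?_, ?_⟩
  · ext y
    simp only [Algebra.algebraMap_eq_smul_one, mul_apply_eq_comp, sub_apply, one_apply_eq_self,
      smul_apply, add_apply, map_add, map_smul]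
    rw [← sub_eq_zero]
    calc _ = μ⁻¹ • (R' y - (R y + μ⁻¹ • R (R' y))) := by
          match_scalars <;> field_simp
          ring
      _ = 0 := by rw [e1, sub_self, smul_zero]
  · ext y
    simp only [Algebra.algebraMap_eq_smul_one, mul_apply_eq_comp, sub_apply, one_apply_eq_self,
      smul_apply, add_apply, map_sub, map_smul]
    rw [← sub_eq_zero]
    calc _ = μ⁻¹ • ((R' y - μ⁻¹ • R' (R y)) - R y) := by
          match_scalars <;> field_simp
          ring
      _ = 0 := by rw [e2, sub_self, smul_zero]

variable [CompleteSpace E]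

theorem LinearPMap.inner_map_eq_of_isSelfAdjoint {A : E →ₗ.[ℂ] E} (hA : IsSelfAdjoint A)
    (x y : A.domain) : ⟪A x, y⟫_ℂ = ⟪(x : E), A y⟫_ℂ := by
  have h := LinearPMap.adjoint_isFormalAdjoint hA.dense_domain
  rw [LinearPMap.isSelfAdjoint_def.1 hA] at h
  exact h x y

theorem LinearPMap.exists_map_eq_of_isSelfAdjoint {A : E →ₗ.[ℂ] E} (hA : IsSelfAdjoint A)
    {u w : E} (h : ∀ y : A.domain, ⟪w, y⟫_ℂ = ⟪u, A y⟫_ℂ) :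
    ∃ hu : u ∈ A.domain, A ⟨u, hu⟩ = w := by
  have hu := LinearPMap.mem_adjoint_domain_of_exists u ⟨w, h⟩
  have e := LinearPMap.adjoint_apply_eq hA.dense_domain ⟨u, hu⟩ h
  revert hu
  rw [LinearPMap.isSelfAdjoint_def.1 hA]
  exact fun hu e => ⟨hu, e⟩

variable {A : E →ₗ.[ℂ] E} {M : Submodule ℂ E}
  {hM : ∀ x : A.domain, (x : E) ∈ M → A x ∈ M}

/-- A linear map `p : E → M` is an orthogonal projection commuting with `A`. -/
structure IsReducingProjection (A : E →ₗ.[ℂ] E) (M : Submodule ℂ E) (p : E →L[ℂ] M) : Prop where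
  inner_eq : ∀ (u : M) (x : E), ⟪(u : E), x⟫_ℂ = ⟪u, p x⟫_ℂ
  apply_coe : ∀ u : M, p u = u
  commutes : ∀ x : A.domain, ∃ h : (p x : E) ∈ A.domain, A ⟨p x, h⟩ = p (A x)

/-- The part in `M` inherits maximality from `A`: for `u, w ∈ M`, testing against `y ∈ Dom A`
amounts to testing against `p y`, which lies in the domain of the part. -/
theorem IsReducingProjection.exists_partIn_eq {p : E →L[ℂ] M} (hp : IsReducingProjection A M p)
    (hA : IsSelfAdjoint A) {u w : M}
    (h : ∀ y : (partIn A M hM).domain, ⟪w, y⟫_ℂ = ⟪u, partIn A M hM y⟫_ℂ) :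
    ∃ hu : u ∈ (partIn A M hM).domain, partIn A M hM ⟨u, hu⟩ = w := by
  obtain ⟨hu, e⟩ := LinearPMap.exists_map_eq_of_isSelfAdjoint hA (u := (u : E)) (w := (w : E))
    fun y => by
      obtain ⟨hy, e⟩ := hp.commutes y
      rw [hp.inner_eq, hp.inner_eq, h ⟨p y, hy⟩]
      congr 1
      exact Subtype.ext e
  exact ⟨hu, Subtype.ext e⟩

theorem IsReducingProjection.dense_domain_partIn {p : E →L[ℂ] M}
    (hp : IsReducingProjection A M p) (hA : IsSelfAdjoint A) :
    Dense ((partIn A M hM).domain : Set M) := by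
  have hsurj : Function.Surjective p := fun u => ⟨u, hp.apply_coe u⟩
  refine (hsurj.denseRange.dense_image p.continuous hA.dense_domain).mono ?_
  rintro _ ⟨x, hx, rfl⟩
  exact (hp.commutes ⟨x, hx⟩).1

theorem inner_partIn_eq (hA : IsSelfAdjoint A) (x y : (partIn A M hM).domain) :
    ⟪partIn A M hM x, y⟫_ℂ = ⟪(x : M), partIn A M hM y⟫_ℂ :=
  LinearPMap.inner_map_eq_of_isSelfAdjoint hA ⟨((x : M) : E), x.2⟩ ⟨((y : M) : E), y.2⟩

/-- A bounded part of a self-adjoint operator is everywhere defined. -/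
theorem IsReducingProjection.exists_bounded_extension [CompleteSpace M] {p : E →L[ℂ] M}
    (hp : IsReducingProjection A M p) (hA : IsSelfAdjoint A) (hb : IsBoundedOp (partIn A M hM)) :
    ∃ a : M →L[ℂ] M, ∀ x, ∃ hx : x ∈ (partIn A M hM).domain, partIn A M hM ⟨x, hx⟩ = a x := by
  obtain ⟨C, hC⟩ := hb
  have hdense := hp.dense_domain_partIn (hM := hM) hA
  have hcont : Continuous (partIn A M hM).toFun :=
    AddMonoidHomClass.continuous_of_bound (partIn A M hM).toFun C hC
  -- Boundedness puts every vector in the domain of the adjoint, and the previous maximality brings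
  -- it back.
  have hmem (u : M) : u ∈ (partIn A M hM).domain := by
    have hu : u ∈ (partIn A M hM).adjoint.domain := by
      rw [LinearPMap.mem_adjoint_domain_iff]
      exact (innerSL ℂ u).continuous.comp hcont
    refine (hp.exists_partIn_eq hA (w := (partIn A M hM).adjoint ⟨u, hu⟩) fun y => ?_).1
    exact LinearPMap.adjoint_isFormalAdjoint hdense ⟨u, hu⟩ y
  refine ⟨LinearMap.mkContinuous
    ((partIn A M hM).toFun.comp (LinearMap.codRestrict _ LinearMap.id hmem)) C fun x => ?_,
    fun x => ⟨hmem x, rfl⟩⟩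
  exact hC ⟨x, hmem x⟩

end UnboundedOperators

theorem setDist_le {s t : Set ℂ} {z w : ℂ} (hz : z ∈ s) (hw : w ∈ t) : setDist s t ≤ dist z w := by
  refine csInf_le ⟨0, ?_⟩ ⟨z, hz, w, hw, rfl⟩
  rintro _ ⟨z, -, w, -, rfl⟩
  exact dist_nonneg

theorem setDist_nonneg (s t : Set ℂ) : 0 ≤ setDist s t := by
  refine Real.sInf_nonneg ?_
  rintro _ ⟨z, -, w, -, rfl⟩
  exact dist_nonneg

/-! ### From the Riccati equation to the norm bound. -/

namespace JPerturbation

variable {H : Type*} [NormedAddCommGroup H] [InnerProductSpace ℂ H] [CompleteSpace H]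
  (S : JPerturbation H)

theorem J_J_apply (x : H) : S.J (S.J x) = x :=
  congrArg (fun f : H →L[ℂ] H => f x) S.J_involution

theorem inner_J (x y : H) : ⟪S.J x, y⟫_ℂ = ⟪x, S.J y⟫_ℂ :=
  ContinuousLinearMap.isSelfAdjoint_iff_isSymmetric.1 S.J_selfAdjoint x y

/-- The orthogonal projection onto `H₀`. -/
noncomputable def proj₀ : H →L[ℂ] S.H₀ :=
  ((2⁻¹ : ℂ) • (1 + S.J)).codRestrict S.H₀ fun x => by
    rw [mem_H₀]
    simp [J_J_apply, add_comm]

/-- The orthogonal projection onto `H₁`. -/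
noncomputable def proj₁ : H →L[ℂ] S.H₁ :=
  ((2⁻¹ : ℂ) • (1 - S.J)).codRestrict S.H₁ fun x => by
    rw [mem_H₁]
    simp only [smul_apply, sub_apply, one_apply_eq_self, map_smul, map_sub, J_J_apply]
    module

theorem coe_proj₀ (x : H) : (S.proj₀ x : H) = (2⁻¹ : ℂ) • (x + S.J x) := rfl

theorem coe_proj₁ (x : H) : (S.proj₁ x : H) = (2⁻¹ : ℂ) • (x - S.J x) := rfl

theorem isReducingProjection_proj₀ : IsReducingProjection S.A S.H₀ S.proj₀ where
  inner_eq u x := by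
    have hu := S.mem_H₀.1 u.2
    rw [Submodule.coe_inner, coe_proj₀, inner_smul_right, inner_add_right, ← inner_J, hu]
    ring
  apply_coe u := by
    have hu := S.mem_H₀.1 u.2
    refine Subtype.ext ?_
    rw [coe_proj₀, hu]
    module
  commutes x := by
    obtain ⟨h, e⟩ := S.A_comm x
    have hd : (S.proj₀ (x : H) : H) ∈ S.A.domain :=
      S.A.domain.smul_mem _ (S.A.domain.add_mem x.2 h)
    refine ⟨hd, ?_⟩
    have : (⟨S.proj₀ (x : H), hd⟩ : S.A.domain) = (2⁻¹ : ℂ) • (x + ⟨S.J x, h⟩) := rfl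
    rw [this, S.A.map_smul, S.A.map_add, e, coe_proj₀]

theorem isReducingProjection_proj₁ : IsReducingProjection S.A S.H₁ S.proj₁ where
  inner_eq u x := by
    have hu := S.mem_H₁.1 u.2
    rw [Submodule.coe_inner, coe_proj₁, inner_smul_right, inner_sub_right, ← inner_J, hu,
      inner_neg_left]
    ring
  apply_coe u := by
    have hu := S.mem_H₁.1 u.2
    refine Subtype.ext ?_
    rw [coe_proj₁, hu]
    module
  commutes x := by
    obtain ⟨h, e⟩ := S.A_comm x
    have hd : (S.proj₁ (x : H) : H) ∈ S.A.domain :=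
      S.A.domain.smul_mem _ (S.A.domain.sub_mem x.2 h)
    refine ⟨hd, ?_⟩
    have : (⟨S.proj₁ (x : H), hd⟩ : S.A.domain) = (2⁻¹ : ℂ) • (x - ⟨S.J x, h⟩) := rfl
    rw [this, S.A.map_smul, S.A.map_sub, e, coe_proj₁]

theorem inner_A₀ (x y : S.A₀.domain) : ⟪S.A₀ x, y⟫_ℂ = ⟪(x : S.H₀), S.A₀ y⟫_ℂ :=
  inner_partIn_eq S.A_selfAdjoint x y

theorem inner_A₁ (x y : S.A₁.domain) : ⟪S.A₁ x, y⟫_ℂ = ⟪(x : S.H₁), S.A₁ y⟫_ℂ :=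
  inner_partIn_eq S.A_selfAdjoint x y

theorem A₁_le_adjoint : S.A₁ ≤ S.A₁.adjoint :=
  LinearPMap.IsFormalAdjoint.le_adjoint
    (S.isReducingProjection_proj₁.dense_domain_partIn S.A_selfAdjoint) S.inner_A₁

variable {S} {K : S.H₀ →L[ℂ] S.H₁}

/-- The weak equation bounds `y ↦ (A₁y, Kx)` by an explicit vector, so maximality of `A₁` puts `Kx`
in its domain. -/
theorem IsWeakRiccatiSolution.isStrong (h : S.IsWeakRiccatiSolution K) :
    S.IsStrongRiccatiSolution K := by
  intro x
  have key (y : S.A₁.domain) :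
      ⟪K (S.A₀ x) + K (S.B (K x)) + S.B.adjoint (x : S.H₀), (y : S.H₁)⟫_ℂ
        = ⟪K (x : S.H₀), S.A₁ y⟫_ℂ := by
    have hy := S.A₁_le_adjoint.1 y.2
    have e := h x ⟨y, hy⟩
    rw [← S.A₁_le_adjoint.2 (x := y) (y := ⟨y, hy⟩) rfl] at e
    have e' : ⟪S.A₁ y, K (x : S.H₀)⟫_ℂ
        = ⟪(y : S.H₁), K (S.A₀ x) + K (S.B (K x)) + S.B.adjoint (x : S.H₀)⟫_ℂ := by
      rw [inner_add_right, inner_add_right]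
      linear_combination -e
    rw [← inner_conj_symm, ← e', inner_conj_symm]
  obtain ⟨hx, e⟩ := S.isReducingProjection_proj₁.exists_partIn_eq S.A_selfAdjoint key
  refine ⟨hx, ?_⟩
  change K (S.A₀ x) - partIn S.A S.H₁ S.A_mem_H₁ ⟨K x, hx⟩ + _ = _
  rw [e]
  abel

set_option maxHeartbeats 800000 in
theorem norm_le_of_isStrongRiccatiSolution (hA₀ : IsBoundedOp S.A₀)
    (h : S.IsStrongRiccatiSolution K) (hK : ‖K‖ < 1)
    (hgap : convexHull ℝ (opSpectrum (S.Z₀ K)) ∩ opSpectrum (S.Z₁ K) = ∅) :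
    ‖K‖ ≤ ‖S.B‖ / √(S.delta K ^ 2 + ‖S.B‖ ^ 2) := by
  -- `H₀` may be zero (`J = -1`); otherwise spec `T` is nonempty and has extreme points.
  rcases subsingleton_or_nontrivial S.H₀ with hH | hH
  · have : K = 0 := by
      ext x
      simp [Subsingleton.elim x 0]
    rw [show ‖K‖ = 0 by rw [this]; exact ContinuousLinearMap.opNorm_zero]
    positivity
  obtain ⟨a, ha⟩ := S.isReducingProjection_proj₀.exists_bounded_extension S.A_selfAdjoint hA₀
  replace ha : ∀ x, ∃ hx : x ∈ S.A₀.domain, S.A₀ ⟨x, hx⟩ = a x := ha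
  have ha_symm (x y : S.H₀) : ⟪a x, y⟫_ℂ = ⟪x, a y⟫_ℂ := by
    obtain ⟨hx, ex⟩ := ha x
    obtain ⟨hy, ey⟩ := ha y
    rw [← ex, ← ey]
    exact S.inner_A₀ ⟨x, hx⟩ ⟨y, hy⟩
  set T : S.H₀ →L[ℂ] S.H₀ := a + S.B.comp K with hTdef
  have hZ₀ : opSpectrum (S.Z₀ K) = spectrum ℂ T := by
    refine opSpectrum_eq_spectrum fun x => ?_
    obtain ⟨hx, ex⟩ := ha x
    refine ⟨hx, ?_⟩
    change S.A₀ ⟨x, hx⟩ + S.B (K x) = a x + S.B (K x)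
    rw [ex]
  have hRic (x : S.H₀) : ∃ hx : K x ∈ S.A₁.domain,
      S.A₁ ⟨K x, hx⟩ = K (T x) + S.B.adjoint x := by
    obtain ⟨hx, ex⟩ := ha x
    obtain ⟨hKx, e⟩ := h ⟨x, hx⟩
    refine ⟨hKx, ?_⟩
    rw [ex] at e
    simp only [hTdef, add_apply, ContinuousLinearMap.comp_apply, map_add]
    rw [← neg_eq_iff_eq_neg] at e
    rw [← e]
    abel
  have hT : IsWeightedSymmetric K T := by
    intro x y
    obtain ⟨hx, ex⟩ := hRic x
    obtain ⟨hy, ey⟩ := hRic y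
    have e := S.inner_A₁ ⟨K x, hx⟩ ⟨K y, hy⟩
    rw [ex, ey] at e
    simp only [inner_add_left, inner_add_right, ContinuousLinearMap.adjoint_inner_left,
      ContinuousLinearMap.adjoint_inner_right] at e
    have e2 := ha_symm x y
    have e3 : ⟪T x, y⟫_ℂ = ⟪a x, y⟫_ℂ + ⟪S.B (K x), y⟫_ℂ := inner_add_left _ _ _
    have e4 : ⟪x, T y⟫_ℂ = ⟪x, a y⟫_ℂ + ⟪x, S.B (K y)⟫_ℂ := inner_add_right _ _ _
    linear_combination e2 + e3 - e4 - e
  -- The adjoint Riccati equation `K*Z₁ = A₀K* + B` on `Dom A₁`. It turns the `K*`-weighted form of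
  -- `Z₁` into a visibly symmetric expression.
  have hKZ (y : S.A₁.domain) : K.adjoint (S.A₁ y - S.B.adjoint (K.adjoint y))
      = a (K.adjoint y) + S.B y := by
    refine ext_inner_right ℂ fun x => ?_
    obtain ⟨hx, ex⟩ := hRic x
    have e := S.inner_A₁ y ⟨K x, hx⟩
    rw [ex] at e
    rw [ContinuousLinearMap.adjoint_inner_left, inner_sub_left, e, inner_add_left, ha_symm,
      ContinuousLinearMap.adjoint_inner_left, ContinuousLinearMap.adjoint_inner_left]
    simp only [inner_add_right, hTdef, add_apply, ContinuousLinearMap.comp_apply, map_add,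
      ContinuousLinearMap.adjoint_inner_right, ContinuousLinearMap.adjoint_inner_left]
    ring
  have hreal {z : ℂ} (hz : z ∈ spectrum ℂ T) : z = (z.re : ℂ) :=
    Complex.ext rfl (by simpa using hT.im_eq_zero hK hz)
  obtain ⟨m, hm, hmin⟩ := (spectrum.isCompact (𝕜 := ℂ) T).exists_isMinOn (spectrum.nonempty T)
    Complex.continuous_re.continuousOn
  obtain ⟨M, hM, hmax⟩ := (spectrum.isCompact (𝕜 := ℂ) T).exists_isMaxOn (spectrum.nonempty T)
    Complex.continuous_re.continuousOn
  have hmM : m.re ≤ M.re := hmin hM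
  have hconv {t : ℝ} (h1 : m.re ≤ t) (h2 : t ≤ M.re) :
      (t : ℂ) ∈ convexHull ℝ (spectrum ℂ T) := by
    refine segment_subset_convexHull hm hM ?_
    rw [hreal hm, hreal hM]
    have := image_segment ℝ Complex.ofRealCLM.toLinearMap.toAffineMap m.re M.re
    rw [segment_eq_Icc hmM] at this
    exact this ▸ ⟨t, ⟨h1, h2⟩, rfl⟩
  have hout {t : ℝ} (ht : (t : ℂ) ∈ opSpectrum (S.Z₁ K)) : t < m.re ∨ M.re < t := by
    by_contra! hcon
    have : (t : ℂ) ∈ convexHull ℝ (opSpectrum (S.Z₀ K)) ∩ opSpectrum (S.Z₁ K) :=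
      ⟨hZ₀ ▸ hconv hcon.1 hcon.2, ht⟩
    rw [hgap] at this
    exact this
  set c : ℝ := (m.re + M.re) / 2 with hc
  set r : ℝ := (M.re - m.re) / 2 with hr
  have hcres : (c : ℂ) ∈ opResolventSet (S.Z₁ K) := by
    by_contra hcs
    rcases hout hcs with h | h <;> linarith
  obtain ⟨R, hR1, hR2⟩ := hcres
  have hTc : IsWeightedSymmetric K (T - algebraMap ℂ _ (c : ℂ)) := by
    intro x y
    have e := hT x y
    simp only [sub_apply, Algebra.algebraMap_eq_smul_one, smul_apply, one_apply_eq_self,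
      inner_sub_left, inner_sub_right, map_sub, map_smul, inner_smul_left, inner_smul_right,
      Complex.conj_ofReal]
    linear_combination e
  have hRs : IsWeightedSymmetric K.adjoint R := by
    -- Substituting `x = (Z₁ - c)p` reduces symmetry of `R` to that of `Z₁ - c`.
    have hR3 (x : S.H₁) : ∃ p : S.A₁.domain, R x = p ∧
        x = S.A₁ p - S.B.adjoint (K.adjoint p) - (c : ℂ) • (p : S.H₁) := by
      obtain ⟨hp, e⟩ := hR1 x
      refine ⟨⟨R x, hp⟩, rfl, ?_⟩
      rw [sub_eq_add_neg (S.A₁ _)]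
      exact e.symm
    intro x y
    obtain ⟨p, hp, hx⟩ := hR3 x
    obtain ⟨q, hq, hy⟩ := hR3 y
    have hKx : K.adjoint x = a (K.adjoint p) + S.B p - (c : ℂ) • K.adjoint p := by
      rw [← hKZ p, hx, map_sub, map_smul]
    have hKy : K.adjoint y = a (K.adjoint q) + S.B q - (c : ℂ) • K.adjoint q := by
      rw [← hKZ q, hy, map_sub, map_smul]
    rw [hKx, hKy, hp, hq, hx, hy]
    have e1 := S.inner_A₁ p q
    have e2 := ha_symm (K.adjoint p) (K.adjoint q)
    simp only [inner_sub_left, inner_sub_right, inner_add_left, inner_add_right, inner_smul_left,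
      inner_smul_right, Complex.conj_ofReal, ContinuousLinearMap.adjoint_inner_left,
      ContinuousLinearMap.adjoint_inner_right, map_sub, map_add, map_smul] at e2 ⊢
    linear_combination e2 - e1
  have hTr : ∀ z ∈ spectrum ℂ (T - algebraMap ℂ _ (c : ℂ)), ‖z‖ ≤ r := by
    intro z hz
    have hz' : z + c ∈ spectrum ℂ T := by
      rw [spectrum.mem_iff] at hz ⊢
      convert hz using 2
      rw [map_add]
      abel
    have h1 : m.re ≤ (z + c).re := hmin hz'
    have h2 : (z + c).re ≤ M.re := hmax hz'
    have h3 := hTc.im_eq_zero hK hz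
    rw [show z = (z.re : ℂ) from Complex.ext rfl (by simpa using h3), Complex.norm_real,
      Real.norm_eq_abs, abs_le]
    simp only [Complex.add_re, Complex.ofReal_re] at h1 h2
    constructor <;> linarith
  have hKadj : ‖K.adjoint‖ < 1 := by rwa [ContinuousLinearMap.adjoint.norm_map]
  obtain ⟨ρ, hρ, hRρ, hρ'⟩ : ∃ ρ : ℝ, 0 ≤ ρ ∧ (∀ z ∈ spectrum ℂ R, ‖z‖ ≤ ρ) ∧
      (ρ = 0 ∨ ∃ μ ∈ spectrum ℂ R, ‖μ‖ = ρ) := by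
    rcases (spectrum ℂ R).eq_empty_or_nonempty with he | hne
    · exact ⟨0, le_rfl, by simp [he], Or.inl rfl⟩
    · obtain ⟨μ, hμ, hmaxμ⟩ := (spectrum.isCompact (𝕜 := ℂ) R).exists_isMaxOn hne
        continuous_norm.continuousOn
      exact ⟨‖μ‖, norm_nonneg _, fun z hz => hmaxμ hz, Or.inr ⟨μ, hμ, rfl⟩⟩
  -- A spectral point `μ` of `R` of largest modulus gives the point `c + μ⁻¹` of spec `Z₁`. It lies
  -- outside `[c - r, c + r]` and at distance at least `δ` from the nearer endpoint, which belongs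
  -- to spec `Z₀`.
  have hbd : ρ = 0 ∨ 0 < ρ ∧ r < ρ⁻¹ ∧ r + S.delta K ≤ ρ⁻¹ := by
    rcases hρ.eq_or_lt with h0 | hpos
    · exact Or.inl h0.symm
    right
    obtain ⟨μ, hμ, hμρ⟩ := hρ'.resolve_left hpos.ne'
    have hμ0 : μ ≠ 0 := norm_pos_iff.1 (hμρ ▸ hpos)
    have hw := add_inv_mem_opSpectrum hR1 hR2 hμ0 hμ
    have hμr : μ = (μ.re : ℂ) := Complex.ext rfl (by simpa using hRs.im_eq_zero hKadj hμ)
    have hw' : ((c + μ.re⁻¹ : ℝ) : ℂ) ∈ opSpectrum (S.Z₁ K) := by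
      rw [hμr] at hw
      exact_mod_cast hw
    have habs : |μ.re⁻¹| = ρ⁻¹ := by
      rw [abs_inv, ← hμρ, hμr, Complex.norm_real, Real.norm_eq_abs, Complex.ofReal_re]
    have hd {z : ℂ} (hz : z ∈ spectrum ℂ T) : S.delta K ≤ |z.re - (c + μ.re⁻¹)| := by
      have := setDist_le (hZ₀.symm ▸ hz) hw'
      rw [hreal hz, Complex.dist_eq, ← Complex.ofReal_sub, Complex.norm_real] at this
      exact this
    refine ⟨hpos, ?_⟩
    rcases hout hw' with h | h
    · have h1 := hd hm
      have h2 := neg_le_abs μ.re⁻¹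
      rw [abs_of_pos (by linarith)] at h1
      constructor <;> linarith
    · have h1 := hd hM
      have h2 := le_abs_self μ.re⁻¹
      rw [abs_of_neg (by linarith)] at h1
      constructor <;> linarith
  refine norm_le_of_sylvester hK S.B hTc hRs (r := r) (ρ := ρ) (by linarith) hρ
    (setDist_nonneg _ _) hTr hRρ ?_ ?_ fun u => ?_
  · rcases hbd with h | ⟨h1, -, h2⟩
    · simp [h]
    · calc ρ * (r + S.delta K) ≤ ρ * ρ⁻¹ := mul_le_mul_of_nonneg_left h2 hρ
        _ = 1 := mul_inv_cancel₀ h1.ne'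
  · rcases hbd with h | ⟨h1, h2, -⟩
    · simp [h]
    · calc ρ * r < ρ * ρ⁻¹ := mul_lt_mul_of_pos_left h2 h1
        _ = 1 := mul_inv_cancel₀ h1.ne'
  · obtain ⟨hu, e⟩ := hRic u
    have := hR2 ⟨K u, hu⟩
    change R (S.A₁ ⟨K u, hu⟩ + -(S.B.adjoint (K.adjoint (K u))) - (c : ℂ) • K u) = K u at this
    refine this.symm.trans (congrArg R ?_)
    rw [e]
    have hTu : (T - algebraMap ℂ _ (c : ℂ)) u = T u - (c : ℂ) • u := by
      rw [sub_apply, Algebra.algebraMap_eq_smul_one]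
      rfl
    rw [hTu, map_sub K, map_smul K, map_sub S.B.adjoint]
    abel

end JPerturbation

/-! ### The extremal example on `ℂ³`. -/

section SharpnessExample

/-- The operator on `ℂ³` with matrix `M`. -/
noncomputable def matrixOp (M : Matrix (Fin 3) (Fin 3) ℂ) :
    EuclideanSpace ℂ (Fin 3) →L[ℂ] EuclideanSpace ℂ (Fin 3) :=
  Matrix.toEuclideanCLM (𝕜 := ℂ) M

theorem matrixOp_apply (M : Matrix (Fin 3) (Fin 3) ℂ) (x : EuclideanSpace ℂ (Fin 3)) (i : Fin 3) :
    matrixOp M x i = M i 0 * x 0 + M i 1 * x 1 + M i 2 * x 2 := by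
  rw [matrixOp, Matrix.ofLp_toEuclideanCLM, Matrix.mulVec, dotProduct, Fin.sum_univ_three]

theorem isSelfAdjoint_matrixOp {M : Matrix (Fin 3) (Fin 3) ℂ} (hM : M.IsHermitian) :
    IsSelfAdjoint (matrixOp M) := by
  rw [IsSelfAdjoint, matrixOp, ← map_star]
  congr 1

/-- The perturbation of `J = diag(1, -1, -1)` on `ℂ³` with `A₀ = 0`, `A₁ = (0 D; D 0)` and
`B = (0 β)`. -/
noncomputable def sharpPerturbation (β D : ℝ) : JPerturbation (EuclideanSpace ℂ (Fin 3)) where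
  J := matrixOp !![1, 0, 0; 0, -1, 0; 0, 0, -1]
  J_selfAdjoint := isSelfAdjoint_matrixOp (by
    ext i j; fin_cases i <;> fin_cases j <;> simp)
  J_involution := by
    ext x i
    fin_cases i <;> simp [mul_apply_eq_comp, matrixOp_apply]
  J_ne_one h := by
    have := congrArg (fun f => f !₂[0, 1, 0] 1) h
    simp [matrixOp_apply, neg_eq_self] at this
  A := (matrixOp !![0, 0, 0; 0, 0, (D : ℂ); 0, (D : ℂ), 0] :
    EuclideanSpace ℂ (Fin 3) →ₗ[ℂ] EuclideanSpace ℂ (Fin 3)).toPMap ⊤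
  A_selfAdjoint := by
    rw [LinearPMap.isSelfAdjoint_def,
      ContinuousLinearMap.toPMap_adjoint_eq_adjoint_toPMap_of_dense _ (by simp),
      ← ContinuousLinearMap.star_eq_adjoint, (isSelfAdjoint_matrixOp _).star_eq]
    ext i j; fin_cases i <;> fin_cases j <;> simp
  A_comm x := by
    refine ⟨trivial, ?_⟩
    change matrixOp _ (matrixOp _ _) = matrixOp _ (matrixOp _ _)
    ext i
    fin_cases i <;> simp [matrixOp_apply]
  V := matrixOp !![0, 0, (β : ℂ); 0, 0, 0; -(β : ℂ), 0, 0]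
  V_selfAdjoint := by
    have : matrixOp !![1, 0, 0; 0, -1, 0; 0, 0, -1] *
        matrixOp !![0, 0, (β : ℂ); 0, 0, 0; -(β : ℂ), 0, 0] =
        matrixOp !![0, 0, (β : ℂ); 0, 0, 0; (β : ℂ), 0, 0] := by
      ext x i
      fin_cases i <;> simp [mul_apply_eq_comp, matrixOp_apply]
    rw [this]
    exact isSelfAdjoint_matrixOp (by ext i j; fin_cases i <;> fin_cases j <;> simp)
  V_anticomm := by
    ext x i
    fin_cases i <;> simp [mul_apply_eq_comp, matrixOp_apply]

namespace sharpPerturbation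

variable {β D : ℝ}

theorem mem_H₀_iff {x : EuclideanSpace ℂ (Fin 3)} :
    x ∈ (sharpPerturbation β D).H₀ ↔ x 1 = 0 ∧ x 2 = 0 := by
  rw [JPerturbation.mem_H₀]
  constructor
  · intro h
    have h1 := congrArg (fun v => v 1) h
    have h2 := congrArg (fun v => v 2) h
    simpa [sharpPerturbation, matrixOp_apply, neg_eq_self] using And.intro h1 h2
  · rintro ⟨h1, h2⟩
    ext i
    fin_cases i <;> simp [sharpPerturbation, matrixOp_apply, h1, h2]

theorem mem_H₁_iff {x : EuclideanSpace ℂ (Fin 3)} :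
    x ∈ (sharpPerturbation β D).H₁ ↔ x 0 = 0 := by
  rw [JPerturbation.mem_H₁]
  constructor
  · intro h
    have h1 := congrArg (fun v => v 0) h
    simpa [sharpPerturbation, matrixOp_apply, self_eq_neg] using h1
  · intro h
    ext i
    fin_cases i <;> simp [sharpPerturbation, matrixOp_apply, h]

variable (β D)

/-- The solution `K = (κ 0)ᵀ` of the Riccati equation when `κ D = β`. -/
noncomputable def solution (κ : ℝ) :
    (sharpPerturbation β D).H₀ →L[ℂ] (sharpPerturbation β D).H₁ :=
  ((matrixOp !![0, 0, 0; (κ : ℂ), 0, 0; 0, 0, 0]).comp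
    (sharpPerturbation β D).H₀.subtypeL).codRestrict _ fun x => by
      simp [mem_H₁_iff, matrixOp_apply]

variable {β D} {κ : ℝ}

theorem coe_solution (x : (sharpPerturbation β D).H₀) :
    (solution β D κ x : EuclideanSpace ℂ (Fin 3)) = !₂[0, κ * x.1 0, 0] := by
  change matrixOp _ _ = _
  ext i
  fin_cases i <;> simp [matrixOp_apply]

theorem coe_B (y : (sharpPerturbation β D).H₁) :
    ((sharpPerturbation β D).B y : EuclideanSpace ℂ (Fin 3)) = !₂[β * y.1 2, 0, 0] := by
  change matrixOp _ _ = _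
  have h := mem_H₁_iff.1 y.2
  ext i
  fin_cases i <;> simp [matrixOp_apply, h]

theorem coe_A₀ (x : (sharpPerturbation β D).A₀.domain) :
    ((sharpPerturbation β D).A₀ x : EuclideanSpace ℂ (Fin 3)) = 0 := by
  change matrixOp _ _ = _
  have h := mem_H₀_iff.1 x.1.2
  ext i
  fin_cases i <;> simp [matrixOp_apply, h]

theorem coe_A₁ (y : (sharpPerturbation β D).A₁.domain) :
    ((sharpPerturbation β D).A₁ y : EuclideanSpace ℂ (Fin 3)) =
      !₂[0, D * y.1.1 2, D * y.1.1 1] := by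
  change matrixOp _ _ = _
  ext i
  fin_cases i <;> simp [matrixOp_apply]

theorem coe_B_adjoint (x : (sharpPerturbation β D).H₀) :
    ((sharpPerturbation β D).B.adjoint x : EuclideanSpace ℂ (Fin 3)) = !₂[0, 0, β * x.1 0] := by
  have hm : !₂[0, 0, β * x.1 0] ∈ (sharpPerturbation β D).H₁ := by simp [mem_H₁_iff]
  suffices (sharpPerturbation β D).B.adjoint x = ⟨_, hm⟩ from congrArg Subtype.val this
  refine ext_inner_right ℂ fun y => ?_
  rw [ContinuousLinearMap.adjoint_inner_left, Submodule.coe_inner, Submodule.coe_inner, coe_B]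
  simp [PiLp.inner_apply, Fin.sum_univ_three]
  ring

theorem coe_solution_adjoint (y : (sharpPerturbation β D).H₁) :
    ((solution β D κ).adjoint y : EuclideanSpace ℂ (Fin 3)) = !₂[κ * y.1 1, 0, 0] := by
  have hm : !₂[κ * y.1 1, 0, 0] ∈ (sharpPerturbation β D).H₀ := by simp [mem_H₀_iff]
  suffices (solution β D κ).adjoint y = ⟨_, hm⟩ from congrArg Subtype.val this
  refine ext_inner_right ℂ fun x => ?_
  rw [ContinuousLinearMap.adjoint_inner_left, Submodule.coe_inner, Submodule.coe_inner,
    coe_solution]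
  simp [PiLp.inner_apply, Fin.sum_univ_three]
  ring

theorem coe_Z₀ (x : ((sharpPerturbation β D).Z₀ (solution β D κ)).domain) :
    (sharpPerturbation β D).Z₀ (solution β D κ) x = 0 := by
  have hx : (x : (sharpPerturbation β D).H₀) ∈ (sharpPerturbation β D).A₀.domain := x.2
  refine Subtype.ext ?_
  change ((sharpPerturbation β D).A₀ ⟨x, hx⟩ : EuclideanSpace ℂ (Fin 3)) +
    ((sharpPerturbation β D).B (solution β D κ x) : EuclideanSpace ℂ (Fin 3)) = 0
  rw [coe_A₀, coe_B, coe_solution]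
  ext i
  fin_cases i <;> simp

theorem coe_Z₁ (y : ((sharpPerturbation β D).Z₁ (solution β D κ)).domain) :
    ((sharpPerturbation β D).Z₁ (solution β D κ) y : EuclideanSpace ℂ (Fin 3)) =
      !₂[0, D * y.1.1 2, (D - β * κ) * y.1.1 1] := by
  have hy : (y : (sharpPerturbation β D).H₁) ∈ (sharpPerturbation β D).A₁.domain := y.2
  change ((sharpPerturbation β D).A₁ ⟨y, hy⟩ : EuclideanSpace ℂ (Fin 3)) +
    -((sharpPerturbation β D).B.adjoint ((solution β D κ).adjoint y) :
      EuclideanSpace ℂ (Fin 3)) = _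
  rw [coe_A₁, coe_B_adjoint, coe_solution_adjoint]
  ext i
  fin_cases i <;> simp
  ring

theorem isStrongRiccatiSolution (h : κ * D = β) :
    (sharpPerturbation β D).IsStrongRiccatiSolution (solution β D κ) := by
  intro x
  refine ⟨trivial, Subtype.ext ?_⟩
  change (solution β D κ ((sharpPerturbation β D).A₀ x) : EuclideanSpace ℂ (Fin 3))
    - ((sharpPerturbation β D).A₁ ⟨solution β D κ x, trivial⟩ : EuclideanSpace ℂ (Fin 3))
    + (solution β D κ ((sharpPerturbation β D).B (solution β D κ x)) : EuclideanSpace ℂ (Fin 3))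
    = -((sharpPerturbation β D).B.adjoint (x : (sharpPerturbation β D).H₀) :
      EuclideanSpace ℂ (Fin 3))
  rw [coe_solution, coe_solution, coe_A₁, coe_B_adjoint, coe_A₀, coe_B, coe_solution]
  have h' : (D : ℂ) * κ = β := by rw [← h]; push_cast; ring
  ext i
  fin_cases i <;> simp [← mul_assoc, h']

theorem isBoundedOp_A₀ : IsBoundedOp (sharpPerturbation β D).A₀ :=
  ⟨0, fun x => by
    rw [zero_mul, Submodule.coe_norm, coe_A₀, norm_zero]⟩

theorem norm_coe_H₀ (x : (sharpPerturbation β D).H₀) : ‖x‖ = ‖x.1 0‖ := by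
  obtain ⟨h1, h2⟩ := mem_H₀_iff.1 x.2
  rw [Submodule.coe_norm, EuclideanSpace.norm_eq, Fin.sum_univ_three, h1, h2]
  simp

/-- The unit vector spanning `H₀`. -/
noncomputable def e₀ (β D : ℝ) : (sharpPerturbation β D).H₀ :=
  ⟨EuclideanSpace.single 0 1, by simp [mem_H₀_iff]⟩

theorem norm_e₀ : ‖e₀ β D‖ = 1 := by
  rw [norm_coe_H₀]
  simp [e₀]

theorem norm_solution (hκ : 0 ≤ κ) : ‖solution β D κ‖ = κ := by
  have h (x : (sharpPerturbation β D).H₀) : ‖solution β D κ x‖ = κ * ‖x‖ := by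
    rw [norm_coe_H₀, Submodule.coe_norm, coe_solution, EuclideanSpace.norm_eq,
      Fin.sum_univ_three]
    simp [abs_of_nonneg hκ, Real.sqrt_sq (mul_nonneg hκ (norm_nonneg (x.1 0)))]
  refine le_antisymm (ContinuousLinearMap.opNorm_le_bound _ hκ fun x => (h x).le) ?_
  have := (solution β D κ).le_opNorm (e₀ β D)
  rwa [h, norm_e₀, mul_one, mul_one] at this

theorem norm_B (hβ : 0 ≤ β) : ‖(sharpPerturbation β D).B‖ = β := by
  have h (y : (sharpPerturbation β D).H₁) : ‖(sharpPerturbation β D).B y‖ = β * ‖y.1 2‖ := by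
    rw [norm_coe_H₀, coe_B]
    simp [abs_of_nonneg hβ]
  refine le_antisymm (ContinuousLinearMap.opNorm_le_bound _ hβ fun y => ?_) ?_
  · rw [h]
    exact mul_le_mul_of_nonneg_left (PiLp.norm_apply_le _ _) hβ
  · have hm : EuclideanSpace.single 2 1 ∈ (sharpPerturbation β D).H₁ := by simp [mem_H₁_iff]
    have := (sharpPerturbation β D).B.le_opNorm ⟨_, hm⟩
    rw [h, Submodule.coe_norm] at this
    simpa using this

theorem opSpectrum_Z₀ : opSpectrum ((sharpPerturbation β D).Z₀ (solution β D κ)) = {0} := by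
  have : Nontrivial (sharpPerturbation β D).H₀ :=
    ⟨e₀ β D, 0, fun h => by simpa [h] using norm_e₀ (β := β) (D := D)⟩
  have h (x : (sharpPerturbation β D).H₀) :
      ∃ hx : x ∈ ((sharpPerturbation β D).Z₀ (solution β D κ)).domain,
        (sharpPerturbation β D).Z₀ (solution β D κ) ⟨x, hx⟩ =
          (0 : (sharpPerturbation β D).H₀ →L[ℂ] (sharpPerturbation β D).H₀) x :=
    ⟨trivial, coe_Z₀ _⟩
  rw [opSpectrum_eq_spectrum h, spectrum.zero_eq]

theorem mem_opSpectrum_Z₁ {μ : ℝ} (hD : D ≠ 0) (hμ : μ ^ 2 = D * (D - β * κ)) :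
    (μ : ℂ) ∈ opSpectrum ((sharpPerturbation β D).Z₁ (solution β D κ)) := by
  rintro ⟨R, -, h2⟩
  -- `(D, μ)` is an eigenvector of `(0 D; D-βκ 0)` for `μ`, nonzero as `D ≠ 0`.
  have hm : !₂[0, (D : ℂ), (μ : ℂ)] ∈ (sharpPerturbation β D).H₁ := by simp [mem_H₁_iff]
  have h := h2 ⟨⟨_, hm⟩, trivial⟩
  have e : (sharpPerturbation β D).Z₁ (solution β D κ) ⟨⟨_, hm⟩, trivial⟩
      - (μ : ℂ) • (⟨_, hm⟩ : (sharpPerturbation β D).H₁) = 0 := by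
    refine Subtype.ext ?_
    rw [Submodule.coe_sub, coe_Z₁]
    have : (μ : ℂ) * μ = D * (D - β * κ) := by rw [← sq]; exact_mod_cast hμ
    ext i
    fin_cases i <;> simp [this] <;> ring
  rw [e, map_zero] at h
  have := congrArg (fun v => v.1 1) h
  simp at this
  exact hD (by exact_mod_cast this.symm)

theorem mem_opResolventSet_Z₁ {z : ℂ} (hz : (D * (D - β * κ) : ℂ) - z ^ 2 ≠ 0) :
    z ∈ opResolventSet ((sharpPerturbation β D).Z₁ (solution β D κ)) := by
  -- `w` is minus the inverse determinant of `Z₁ - z`; `R` below is Cramer's rule.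
  let w : ℂ := (D * (D - β * κ) - z ^ 2)⁻¹
  have hw : w * (D * (D - β * κ) - z ^ 2) = 1 := inv_mul_cancel₀ hz
  let R : (sharpPerturbation β D).H₁ →L[ℂ] (sharpPerturbation β D).H₁ :=
    ((matrixOp !![0, 0, 0; 0, w * z, w * D; 0, w * (D - β * κ), w * z]).comp
      (sharpPerturbation β D).H₁.subtypeL).codRestrict _ fun x => by
        simp [mem_H₁_iff, matrixOp_apply]
  have hR (y : (sharpPerturbation β D).H₁) : (R y : EuclideanSpace ℂ (Fin 3)) =
      !₂[0, w * z * y.1 1 + w * D * y.1 2, w * (D - β * κ) * y.1 1 + w * z * y.1 2] := by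
    change matrixOp _ _ = _
    ext i
    fin_cases i <;> simp [matrixOp_apply]
  refine ⟨R, fun y => ⟨trivial, Subtype.ext ?_⟩, fun x => Subtype.ext ?_⟩
  · have hy := mem_H₁_iff.1 y.2
    rw [Submodule.coe_sub, Submodule.coe_smul, coe_Z₁, hR]
    ext i
    fin_cases i
    · simp [hy]
    · simp
      linear_combination y.1 1 * hw
    · simp
      linear_combination y.1 2 * hw
  · have hx := mem_H₁_iff.1 x.1.2
    rw [hR, Submodule.coe_sub, Submodule.coe_smul, coe_Z₁]
    ext i
    fin_cases i
    · simp [hx]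
    · simp
      linear_combination x.1.1 1 * hw
    · simp
      linear_combination x.1.1 2 * hw

theorem opSpectrum_Z₁ {δ : ℝ} (hD : D ≠ 0) (hδ : δ ^ 2 = D * (D - β * κ)) :
    opSpectrum ((sharpPerturbation β D).Z₁ (solution β D κ)) = {(δ : ℂ), ((-δ : ℝ) : ℂ)} := by
  ext z
  constructor
  · intro hz
    by_contra hne
    refine hz (mem_opResolventSet_Z₁ fun h0 => hne ?_)
    have h1 : (D * (D - β * κ) : ℂ) = (δ : ℂ) ^ 2 := by exact_mod_cast hδ.symm
    rw [h1, sub_eq_zero] at h0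
    rcases sq_eq_sq_iff_eq_or_eq_neg.1 h0.symm with h | h
    · exact Or.inl h
    · right
      simpa using h
  · rintro (rfl | rfl)
    · exact mem_opSpectrum_Z₁ hD hδ
    · exact mem_opSpectrum_Z₁ hD (by rw [neg_sq, hδ])

end sharpPerturbation

end SharpnessExample

/-! ### Assembly of the bound and its sharpness. -/

theorem theorem3p9 :
    (∀ (H : Type*) [NormedAddCommGroup H] [InnerProductSpace ℂ H] [CompleteSpace H]
        (S : JPerturbation H) (K : S.H₀ →L[ℂ] S.H₁),
      IsBoundedOp S.A₀ → S.IsWeakRiccatiSolution K → ‖K‖ < 1 →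
      convexHull ℝ (opSpectrum (S.Z₀ K)) ∩ opSpectrum (S.Z₁ K) = ∅ →
      ‖K‖ ≤ ‖S.B‖ / √(S.delta K ^ 2 + ‖S.B‖ ^ 2)) ∧
    (∀ β δ : ℝ, 0 ≤ β → 0 < δ →
      ∃ (H : Type) (_ : NormedAddCommGroup H) (_ : InnerProductSpace ℂ H) (_ : CompleteSpace H)
        (S : JPerturbation H) (K : S.H₀ →L[ℂ] S.H₁),
        IsBoundedOp S.A₀ ∧ S.IsStrongRiccatiSolution K ∧ ‖K‖ < 1 ∧
        (∃ a b : ℝ, IsFiniteGap (opSpectrum (S.Z₁ K)) a b ∧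
          opSpectrum (S.Z₀ K) ⊆ Complex.ofReal '' Set.Ioo a b) ∧
        ‖S.B‖ = β ∧ S.delta K = δ ∧
        ‖K‖ = β / √(δ ^ 2 + β ^ 2)) := by
  refine ⟨fun H _ _ _ S K hA₀ h hK hgap =>
    JPerturbation.norm_le_of_isStrongRiccatiSolution hA₀ h.isStrong hK hgap,
    fun β δ hβ hδ => ?_⟩
  -- With `κ = β/D`, this `D` makes the squared eigenvalues `D(D - βκ) = D² - β²` equal to `δ²`.
  set D := √(δ ^ 2 + β ^ 2) with hD
  have hDpos : 0 < D := Real.sqrt_pos.2 (by positivity)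
  have hDD : D ^ 2 = δ ^ 2 + β ^ 2 := Real.sq_sqrt (by positivity)
  have hκ : 0 ≤ β / D := by positivity
  have hκD : β / D * D = β := div_mul_cancel₀ _ hDpos.ne'
  have hδ2 : δ ^ 2 = D * (D - β * (β / D)) := by
    rw [mul_sub, ← sq, hDD]
    linear_combination β * hκD
  have hZ₀ := sharpPerturbation.opSpectrum_Z₀ (β := β) (D := D) (κ := β / D)
  have hZ₁ := sharpPerturbation.opSpectrum_Z₁ hDpos.ne' hδ2
  refine ⟨EuclideanSpace ℂ (Fin 3), inferInstance, inferInstance, inferInstance,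
    sharpPerturbation β D, sharpPerturbation.solution β D (β / D),
    sharpPerturbation.isBoundedOp_A₀, sharpPerturbation.isStrongRiccatiSolution hκD, ?_,
    ⟨-δ, δ, ⟨by linarith, ?_, ?_, fun t h1 h2 => ?_⟩, ?_⟩, sharpPerturbation.norm_B hβ, ?_,
    sharpPerturbation.norm_solution hκ⟩
  · rw [sharpPerturbation.norm_solution hκ, div_lt_one hDpos]
    exact lt_of_pow_lt_pow_left₀ 2 hDpos.le (by rw [hDD]; nlinarith)
  · rw [hZ₁]
    simp
  · rw [hZ₁]
    simp
  · rw [hZ₁]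
    rintro (h | h)
    · exact h2.ne (Complex.ofReal_injective h)
    · exact h1.ne' (Complex.ofReal_injective h)
  · rw [hZ₀]
    rintro _ rfl
    exact ⟨0, ⟨by linarith, hδ⟩, rfl⟩
  · rw [JPerturbation.delta, hZ₀, hZ₁, setDist]
    have : {r : ℝ | ∃ z ∈ ({0} : Set ℂ), ∃ w ∈ ({(δ : ℂ), ((-δ : ℝ) : ℂ)} : Set ℂ),
        r = dist z w} = {δ} := by
      ext r
      simp [abs_of_pos hδ]
    rw [this, csInf_singleton]
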